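/- **Theorem 1 (unanimity).** Let $\mu_0,\mu_1$ be probability measures on a measurable space $(\Omega,\mathcal O)$ such that the Radon–Nikodym derivative $\frac{d\mu_1}{d\mu_0}$ exists and is non-zero $\mu_0$-almost everywhere, and such that the log-likelihood ratio $X=\log\frac{d\mu_1}{d\mu_0}(A)$ has a non-atomic distribution when $A\sim\frac12\mu_0+\frac12\mu_1$. Let $n$ be a finite number of agents, and let $(S,A_1,\dots,A_n)\in\{0,1\}\times\Omega^n$ have law $$\mathbb P=\tfrac12\,\delta_0\otimes\mu_0^{\otimes n}+\tfrac12\,\delta_1\otimes\mu_1^{\otimes n},$$ where $\delta_s$ is the point mass at $s$; that is, the state $S$ is uniform on $\{0,1\}$ and, given $S$, the private signals $A_1,\dots,A_n$ are i.i.d. with distribution $\mu_S$. For $t=1,2,\dots$ and each agent $i$, the vote of agent $i$ in round $t$ is defined recursively by $$V_i(t)=\begin{cases}1&\text{if }\ \mathbb P\big[S=1\mid A_i,\ V_j(t')\ (1\le j\le n,\ 1\le t'<t)\big]>\tfrac12,\\ 0&\text{otherwise.}\end{cases}$$ Then with $\mathbb P$-probability one there exist a time $t_u\ge 1$ and a vote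 $V\in\{0,1\}$ such that $V_i(t)=V$ for all $t\ge t_u$ and all agents $i$. -/

import Mathlib

open MeasureTheory ProbabilityTheory
open scoped ENNReal

namespace RepeatedVoting

variable {Ω : Type*} [MeasurableSpace Ω]

/-- The standing assumptions on the signal distributions: `dμ₁/dμ₀` exists and is non-zero
(almost everywhere, which is the same as having a version that is non-zero at every point), and
the log-likelihood ratio `X = log (dμ₁/dμ₀)(A)`, `A ∼ ½ μ₀ + ½ μ₁`, has a non-atomic
distribution. -/
structure IsAdmissible (μ₀ μ₁ : Measure Ω) : Prop where
  absolutelyContinuous : μ₁ ≪ μ₀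
  rnDeriv_ne_zero : ∀ᵐ ω ∂μ₀, μ₁.rnDeriv μ₀ ω ≠ 0
  nonatomic : ∀ x : ℝ,
    (((1 / 2 : ℝ≥0∞) • μ₀ + (1 / 2 : ℝ≥0∞) • μ₁).map (llr μ₁ μ₀)) {x} = 0

/-- The sample space `{0,1} × Ωⁿ`. -/
abbrev Outcome (n : ℕ) (Ω : Type*) : Type _ := Fin 2 × (Fin n → Ω)

/-- The state of the world `S`. -/
def state {n : ℕ} (z : Outcome n Ω) : Fin 2 := z.1

/-- The private signal `A_i`. -/
def signal {n : ℕ} (i : Fin n) (z : Outcome n Ω) : Ω := z.2 i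

/-- The law `½ δ₀ ⊗ μ₀^{⊗ n} + ½ δ₁ ⊗ μ₁^{⊗ n}` of the state and the signals. -/
noncomputable def law (n : ℕ) (μ₀ μ₁ : Measure Ω) : Measure (Outcome n Ω) :=
  (1 / 2 : ℝ≥0∞) • (Measure.dirac (0 : Fin 2)).prod (Measure.pi fun _ : Fin n => μ₀) +
    (1 / 2 : ℝ≥0∞) • (Measure.dirac (1 : Fin 2)).prod (Measure.pi fun _ : Fin n => μ₁)

/-- The vote of agent `i` when its information consists of its signal and of the `σ`-algebra `𝓗`:
`1` if `ℙ(S = 1 | A_i, 𝓗) > 1/2`, and `0` otherwise. -/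
noncomputable def voteGiven {n : ℕ} (μ₀ μ₁ : Measure Ω) (𝓗 : MeasurableSpace (Outcome n Ω))
    (i : Fin n) (z : Outcome n Ω) : Fin 2 :=
  if 1 / 2 <
      ((law n μ₀ μ₁)⟦{y | state y = 1} | MeasurableSpace.comap (signal i) inferInstance ⊔ 𝓗⟧) z
  then 1 else 0

/-- The `σ`-algebra generated by the votes of all agents in the rounds `1, …, t`. -/
@[reducible]
noncomputable def publicInfo {n : ℕ} (μ₀ μ₁ : Measure Ω) : ℕ → MeasurableSpace (Outcome n Ω)
  | 0 => ⊥
  | t + 1 => publicInfo μ₀ μ₁ t ⊔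
      ⨆ j : Fin n, MeasurableSpace.comap (voteGiven μ₀ μ₁ (publicInfo μ₀ μ₁ t) j) inferInstance

/-- `V_i(t)`, the vote of agent `i` in round `t`, for `t ≥ 1` (the value at `t = 0` has no
meaning). -/
noncomputable def vote {n : ℕ} (μ₀ μ₁ : Measure Ω) (t : ℕ) (i : Fin n) :
    Outcome n Ω → Fin 2 :=
  voteGiven μ₀ μ₁ (publicInfo μ₀ μ₁ (t - 1)) i

/-- The public information after round `t` is generated by the votes in the rounds `1, …, t`. -/
theorem publicInfo_eq {n : ℕ} (μ₀ μ₁ : Measure Ω) (t : ℕ) :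
    publicInfo (n := n) μ₀ μ₁ t =
      ⨆ s ∈ Finset.Icc 1 t, ⨆ j : Fin n,
        MeasurableSpace.comap (vote μ₀ μ₁ s j) inferInstance := by
  induction t with
  | zero => simp [publicInfo]
  | succ t ih =>
    rw [← Finset.insert_Icc_right_eq_Icc_add_one (by omega), Finset.iSup_insert, ← ih, sup_comm,
      publicInfo]
    rfl

/-- The information of each agent is a sub-`σ`-algebra of the one on the sample space, so that the
conditional probabilities above are the genuine ones. -/
theorem info_le {n : ℕ} (μ₀ μ₁ : Measure Ω) (t : ℕ) (i : Fin n) :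
    MeasurableSpace.comap (signal i) inferInstance ⊔ publicInfo μ₀ μ₁ t ≤
      (inferInstance : MeasurableSpace (Outcome n Ω)) := by
  have hs : ∀ j : Fin n, MeasurableSpace.comap (signal j) inferInstance ≤
      (inferInstance : MeasurableSpace (Outcome n Ω)) := fun j =>
    Measurable.comap_le ((measurable_pi_apply j).comp measurable_snd)
  refine sup_le (hs i) ?_
  induction t with
  | zero => exact bot_le
  | succ t ih =>
    refine sup_le ih (iSup_le fun j => Measurable.comap_le ?_)
    refine Measurable.ite (measurableSet_lt measurable_const ?_) measurable_const measurable_const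
    exact stronglyMeasurable_condExp.measurable.mono (sup_le (hs j) ih) le_rfl

end RepeatedVoting

/-! Beliefs are bounded martingales, so each agent's belief converges, as does the belief based on
the votes alone. Votes are public, so "agent `j` votes 0 infinitely often" is a public event; on it
the agent's limiting belief is at most 1/2, and averaging bounds the public belief in the same way.
With the symmetric bound for votes 1, a limiting public belief other than 1/2 forces all votes to
agree eventually (`unanimity_of_limit_belief_ne_half`).

It remains to exclude a limiting public belief of 1/2 (`limit_belief_ne_half`). On that event every
agent's limiting belief is 1/2 as well. Given the public information the signals stay independent in
each state, so an agent's odds are `l (A_j) * g`, with `l` the density of `μ₁` and `g` public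
(`GeneratedByBoxes.exists_density`). Limiting odds 1 make each `l (A_j)` a function of the votes.
The votes then reveal the posterior given all signals, which must be 1/2, so the product of the `l
(A_i)` is 1. Non-atomicity makes this a null event. -/

namespace RepeatedVoting

open Filter Topology
open scoped NNReal

/-! ### Bayes' rule for two equally likely states -/

/-- Bayes' rule: if the states `0` and `1` are equally likely and on the information `G` the law
in state `1` has density `r` with respect to the law in state `0`, then the posterior probability
of state `1` is `r / (1 + r)`. -/
theorem condExp_half_add_half {α : Type*} {G m₀ : MeasurableSpace α} (hG : G ≤ m₀)
    {P₀ P₁ : Measure α} [IsProbabilityMeasure P₀] [IsProbabilityMeasure P₁]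
    {S : Set α} (hS : MeasurableSet S) (h₀ : P₀ S = 0) (h₁ : P₁ Sᶜ = 0)
    {r : α → ℝ≥0} (hr : Measurable[G] r)
    (hD : ∀ D, MeasurableSet[G] D → P₁ D = ∫⁻ z in D, r z ∂P₀) :
    (fun z => (r z : ℝ) / (1 + r z)) =ᵐ[(1 / 2 : ℝ≥0∞) • P₀ + (1 / 2 : ℝ≥0∞) • P₁]
      ((1 / 2 : ℝ≥0∞) • P₀ + (1 / 2 : ℝ≥0∞) • P₁)⟦S | G⟧ := by
  have hfin : IsFiniteMeasure ((1 / 2 : ℝ≥0∞) • P₀ + (1 / 2 : ℝ≥0∞) • P₁) := by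
    constructor
    simp
  have hr' : Measurable r := hr.mono hG le_rfl
  have hqm : Measurable[G] fun z => (r z / (1 + r z) : ℝ≥0) := hr.div (hr.const_add 1)
  have hqm' : Measurable fun z => (r z / (1 + r z) : ℝ≥0) := hqm.mono hG le_rfl
  have hq1 : ∀ z, (r z / (1 + r z) : ℝ≥0) ≤ 1 := fun z =>
    div_le_one_of_le₀ le_add_self zero_le
  have hcast : (fun z => (r z : ℝ) / (1 + r z)) = fun z => (((r z / (1 + r z) : ℝ≥0)) : ℝ) := by
    ext z; push_cast; rfl
  -- The density relation is known only on events of `G`, so the change of measure is made between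
  -- the trimmed measures.
  have htrim : P₁.trim hG = (P₀.trim hG).withDensity fun z => (r z : ℝ≥0∞) := by
    refine @Measure.ext _ G _ _ fun D hDm => ?_
    rw [trim_measurableSet_eq hG hDm, withDensity_apply _ hDm, restrict_trim hG _ hDm,
      lintegral_trim hG hr.coe_nnreal_ennreal, hD D hDm]
  rw [hcast]
  refine ae_eq_condExp_of_forall_setIntegral_eq hG ?_ ?_ ?_ ?_
  · exact (integrable_const (1 : ℝ)).indicator hS
  · intro D _ _
    refine Integrable.integrableOn (Integrable.of_bound
      (hqm'.coe_nnreal_real.aestronglyMeasurable) 1 (ae_of_all _ fun z => ?_))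
    rw [Real.norm_of_nonneg (NNReal.coe_nonneg _)]
    exact_mod_cast hq1 z
  · intro D hDm _
    have hDm' := hG D hDm
    have e0 : P₁ (D ∩ S) = P₁ D := by
      refine measure_inter_conull' (measure_mono_null ?_ h₁)
      exact fun z hz => hz.2
    have e1 : P₀ (D ∩ S) = 0 := measure_mono_null Set.inter_subset_right h₀
    -- With `q = r / (1 + r)`, this is `q + r * q = r` integrated against `P₀`.
    have key : ∫⁻ z in D, ((r z / (1 + r z) : ℝ≥0) : ℝ≥0∞) ∂P₀
        + ∫⁻ z in D, ((r z / (1 + r z) : ℝ≥0) : ℝ≥0∞) ∂P₁ = P₁ D := by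
      have : ∫⁻ z in D, ((r z / (1 + r z) : ℝ≥0) : ℝ≥0∞) ∂P₁ =
          ∫⁻ z in D, (r z : ℝ≥0∞) * ((r z / (1 + r z) : ℝ≥0) : ℝ≥0∞) ∂P₀ := by
        rw [← lintegral_trim hG hqm.coe_nnreal_ennreal, ← restrict_trim hG _ hDm, htrim,
          setLIntegral_withDensity_eq_setLIntegral_mul _ hr.coe_nnreal_ennreal
            hqm.coe_nnreal_ennreal hDm, restrict_trim hG _ hDm]
        exact lintegral_trim hG (hr.coe_nnreal_ennreal.mul hqm.coe_nnreal_ennreal)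
      rw [this, ← lintegral_add_left hqm'.coe_nnreal_ennreal, hD D hDm]
      refine lintegral_congr fun z => ?_
      rw [← ENNReal.coe_mul, ← ENNReal.coe_add]
      congr 1
      have : (1 + r z) ≠ 0 := by positivity
      field_simp
    rw [integral_eq_lintegral_of_nonneg_ae (ae_of_all _ fun z => NNReal.coe_nonneg _)
      hqm'.coe_nnreal_real.aestronglyMeasurable, setIntegral_indicator hS]
    simp only [ENNReal.ofReal_coe_nnreal, Measure.restrict_add, Measure.restrict_smul,
      lintegral_add_measure, lintegral_smul_measure, smul_eq_mul]
    rw [← mul_add, key]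
    simp [measureReal_def, e0, e1]
  · exact (hqm.coe_nnreal_real.stronglyMeasurable).aestronglyMeasurable

/-! ### Densities and level sets for product measures -/

theorem setLIntegral_pi_prod {ι Ω : Type*} [Fintype ι] [MeasurableSpace Ω] (μ : ι → Measure Ω)
    [∀ i, IsProbabilityMeasure (μ i)] {f : ι → Ω → ℝ≥0∞} (hf : ∀ i, Measurable (f i))
    {B : ι → Set Ω} (hB : ∀ i, MeasurableSet (B i)) :
    ∫⁻ x in Set.univ.pi B, ∏ i, f i (x i) ∂(Measure.pi μ) = ∏ i, ∫⁻ a in B i, f i a ∂(μ i) := by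
  have hX : ∀ i, Measurable ((B i).indicator (f i)) := fun i => (hf i).indicator (hB i)
  rw [← lintegral_indicator (MeasurableSet.univ_pi hB)]
  have e : (Set.univ.pi B).indicator (fun x => ∏ i, f i (x i)) =
      fun x => ∏ i, (B i).indicator (f i) (x i) := by
    ext x
    by_cases hx : x ∈ Set.univ.pi B
    · rw [Set.indicator_of_mem hx]
      exact Finset.prod_congr rfl fun i _ => (Set.indicator_of_mem (hx i trivial) _).symm
    · rw [Set.indicator_of_notMem hx]
      obtain ⟨i, hi⟩ : ∃ i, x i ∉ B i := by simpa using hx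
      exact (Finset.prod_eq_zero (Finset.mem_univ i) (Set.indicator_of_notMem hi _)).symm
  rw [e, lintegral_prod_eq_prod_lintegral_of_indepFun Finset.univ
    (fun i (x : ι → Ω) => (B i).indicator (f i) (x i))
    (iIndepFun_pi fun i => (hX i).aemeasurable)
    fun i => (hX i).comp (measurable_pi_apply i)]
  refine Finset.prod_congr rfl fun i _ => ?_
  rw [← lintegral_indicator (hB i)]
  exact (measurePreserving_eval μ i).lintegral_comp (hX i)

theorem pi_withDensity {ι Ω : Type*} [Fintype ι] [MeasurableSpace Ω] (μ ν : Measure Ω)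
    [IsProbabilityMeasure μ] [IsProbabilityMeasure ν] {f : Ω → ℝ≥0∞} (hf : Measurable f)
    (hν : ν = μ.withDensity f) :
    (Measure.pi fun _ : ι => ν) =
      (Measure.pi fun _ : ι => μ).withDensity fun x => ∏ i, f (x i) := by
  refine Measure.pi_eq fun B hB => ?_
  rw [withDensity_apply _ (MeasurableSet.univ_pi hB),
    setLIntegral_pi_prod (fun _ => μ) (fun _ => hf) hB]
  refine Finset.prod_congr rfl fun i _ => ?_
  rw [hν, withDensity_apply _ (hB i)]

/-- If the nonzero level sets of `f` are null, then the event that the product of the values of `f`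
at the coordinates is `1` is null. -/
theorem pi_prod_eq_one_null {Ω : Type*} [MeasurableSpace Ω] {n : ℕ} (hn : n ≠ 0) (μ : Measure Ω)
    [IsProbabilityMeasure μ] {f : Ω → ℝ≥0} (hf : Measurable f)
    (hnull : ∀ c, c ≠ 0 → μ {a | f a = c} = 0) :
    Measure.pi (fun _ : Fin n => μ) {x | ∏ i, f (x i) = 1} = 0 := by
  obtain ⟨m, rfl⟩ := Nat.exists_eq_succ_of_ne_zero hn
  have hmp := measurePreserving_piFinSuccAbove (fun _ : Fin (m + 1) => μ) 0
  have hms : MeasurableSet {p : Ω × (Fin m → Ω) | f p.1 * ∏ i, f (p.2 i) = 1} := by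
    refine measurableSet_eq_fun ?_ measurable_const
    exact (hf.comp measurable_fst).mul (Finset.measurable_fun_prod _ fun i _ =>
      hf.comp ((measurable_pi_apply i).comp measurable_snd))
  have e : {x : Fin (m + 1) → Ω | ∏ i, f (x i) = 1} =
      MeasurableEquiv.piFinSuccAbove (fun _ => Ω) 0 ⁻¹'
        {p : Ω × (Fin m → Ω) | f p.1 * ∏ i, f (p.2 i) = 1} := by
    ext x
    simp [Fin.prod_univ_succ, Fin.tail]
  rw [e, hmp.measure_preimage hms.nullMeasurableSet,
    ← Measure.measurePreserving_swap.measure_preimage hms.nullMeasurableSet,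
    Measure.measure_prod_null (measurable_swap hms)]
  refine ae_of_all _ fun y => ?_
  -- With the other coordinates frozen, the equation is `0 = 1` or pins the first factor to one
  -- nonzero value.
  by_cases hc : ∏ i, f (y i) = 0
  · simp [hc]
  · refine measure_mono_null ?_ (hnull (∏ i, f (y i))⁻¹ (inv_ne_zero hc))
    intro a ha
    exact eq_inv_of_mul_eq_one_left ha

/-! ### Conditional laws and the box structure of public information -/

variable {Ω : Type*} [MeasurableSpace Ω] {n : ℕ}

/-- The law of the state and the signals conditioned on the state being `s`. -/
noncomputable def stateLaw (n : ℕ) (s : Fin 2) (μ : Measure Ω) : Measure (Outcome n Ω) :=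
  (Measure.dirac s).prod (Measure.pi fun _ : Fin n => μ)

theorem law_eq (n : ℕ) (μ₀ μ₁ : Measure Ω) :
    law n μ₀ μ₁ = (1 / 2 : ℝ≥0∞) • stateLaw n 0 μ₀ + (1 / 2 : ℝ≥0∞) • stateLaw n 1 μ₁ := rfl

instance (s : Fin 2) (μ : Measure Ω) [IsProbabilityMeasure μ] :
    IsProbabilityMeasure (stateLaw n s μ) := by
  unfold stateLaw; infer_instance

instance (μ₀ μ₁ : Measure Ω) [IsProbabilityMeasure μ₀] [IsProbabilityMeasure μ₁] :
    IsProbabilityMeasure (law n μ₀ μ₁) := by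
  constructor
  simp [law_eq, ENNReal.inv_two_add_inv_two]

theorem stateLaw_preimage_snd (s : Fin 2) (μ : Measure Ω) [IsProbabilityMeasure μ]
    {D : Set (Fin n → Ω)} (hD : MeasurableSet D) :
    stateLaw n s μ (Prod.snd ⁻¹' D) = Measure.pi (fun _ : Fin n => μ) D :=
  measurePreserving_snd.measure_preimage hD.nullMeasurableSet

theorem setLIntegral_stateLaw (s : Fin 2) (μ : Measure Ω) [IsProbabilityMeasure μ]
    {D : Set (Fin n → Ω)} (hD : MeasurableSet D) {f : (Fin n → Ω) → ℝ≥0∞} (hf : Measurable f) :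
    ∫⁻ z in Prod.snd ⁻¹' D, f z.2 ∂(stateLaw n s μ) =
      ∫⁻ x in D, f x ∂(Measure.pi fun _ : Fin n => μ) :=
  measurePreserving_snd.setLIntegral_comp_preimage hD hf

/-- A `σ`-algebra generated by a map with finitely many values, every fibre of which is a product
of measurable conditions on the individual signals. -/
def GeneratedByBoxes (m : MeasurableSpace (Outcome n Ω)) : Prop :=
  ∃ (K : Type) (_ : Fintype K) (mK : MeasurableSpace K) (_ : MeasurableSingletonClass K)
    (f : Outcome n Ω → K) (B : K → Fin n → Set Ω), (∀ k i, MeasurableSet (B k i)) ∧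
      m = MeasurableSpace.comap f mK ∧ ∀ k, f ⁻¹' {k} = Prod.snd ⁻¹' (Set.univ.pi (B k))

theorem generatedByBoxes_bot : GeneratedByBoxes (⊥ : MeasurableSpace (Outcome n Ω)) := by
  refine ⟨Unit, inferInstance, inferInstance, inferInstance, fun _ => (), fun _ _ => Set.univ,
    fun _ _ => MeasurableSet.univ, (MeasurableSpace.comap_const _).symm, fun k => ?_⟩
  ext z; simp

/-- Once the old public value is fixed, the vote of agent `j` depends on its own signal only.
Observing it shrinks only the `j`-th side of the box. -/
theorem GeneratedByBoxes.sup_comap {m : MeasurableSpace (Outcome n Ω)} (hm : GeneratedByBoxes m)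
    {v : Fin n → Outcome n Ω → Fin 2}
    (hv : ∀ j, Measurable[MeasurableSpace.comap (signal j) inferInstance ⊔ m] (v j)) :
    GeneratedByBoxes (m ⊔ ⨆ j, MeasurableSpace.comap (v j) inferInstance) := by
  obtain ⟨K, hK, mK, hsK, f, B, hB, rfl, hf⟩ := hm
  have hv' : ∀ j, Measurable[MeasurableSpace.comap (fun z => (signal j z, f z)) inferInstance]
      (v j) := fun j => (MeasurableSpace.comap_prodMk (signal j) f).symm ▸ hv j
  choose T hT hTv using fun j b => hv' j (measurableSet_singleton b)
  refine ⟨K × (Fin n → Fin 2), inferInstance, inferInstance, inferInstance,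
    fun z => (f z, fun j => v j z), fun p i => B p.1 i ∩ (fun a => (a, p.1)) ⁻¹' T i (p.2 i),
    fun p i => ?_, ?_, fun p => ?_⟩
  · exact (hB _ _).inter (measurable_prodMk_right (hT i (p.2 i)))
  · refine Eq.trans ?_ (MeasurableSpace.comap_prodMk f fun z j => v j z).symm
    simp only [MeasurableSpace.pi, MeasurableSpace.comap_iSup, MeasurableSpace.comap_comp]
    rfl
  · obtain ⟨k, b⟩ := p
    have hmem : ∀ z j, v j z = b j ↔ (signal j z, f z) ∈ T j (b j) := fun z j => by
      have := Set.ext_iff.1 (hTv j (b j)) z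
      simpa using this.symm
    have hfk : ∀ z, f z = k ↔ ∀ i, z.2 i ∈ B k i := fun z => by
      have := Set.ext_iff.1 (hf k) z
      simpa using this
    ext z
    simp only [Set.mem_preimage, Set.mem_singleton_iff, Prod.mk.injEq, funext_iff, Set.mem_pi,
      Set.mem_univ, true_imp_iff, Set.mem_inter_iff, forall_and, ← hfk, hmem]
    refine and_congr_right fun h => ?_
    rw [h]
    rfl

theorem measurable_voteGiven (μ₀ μ₁ : Measure Ω) (m : MeasurableSpace (Outcome n Ω)) (j : Fin n) :
    Measurable[MeasurableSpace.comap (signal j) inferInstance ⊔ m] (voteGiven μ₀ μ₁ m j) :=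
  Measurable.ite (measurableSet_lt measurable_const stronglyMeasurable_condExp.measurable)
    measurable_const measurable_const

theorem generatedByBoxes_publicInfo (μ₀ μ₁ : Measure Ω) (t : ℕ) :
    GeneratedByBoxes (publicInfo (n := n) μ₀ μ₁ t) := by
  induction t with
  | zero => exact generatedByBoxes_bot
  | succ t ih => exact ih.sup_comap fun j => measurable_voteGiven μ₀ μ₁ _ j

/-- Given public information generated by boxes, the likelihood ratio of agent `j` is the product
of the likelihood ratio of its signal and of a function of the public information. -/
theorem GeneratedByBoxes.exists_density {m : MeasurableSpace (Outcome n Ω)}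
    (hm : GeneratedByBoxes m) (μ₀ μ₁ : Measure Ω)
    [IsProbabilityMeasure μ₀] [IsProbabilityMeasure μ₁] {l : Ω → ℝ≥0} (hl : Measurable l)
    (hμ : μ₁ = μ₀.withDensity fun a => l a) (j : Fin n) :
    ∃ g : Outcome n Ω → ℝ≥0, Measurable[m] g ∧
      ∀ D, MeasurableSet[MeasurableSpace.comap (signal j) inferInstance ⊔ m] D →
        stateLaw n 1 μ₁ D = ∫⁻ z in D, ((l (signal j z) * g z : ℝ≥0) : ℝ≥0∞) ∂stateLaw n 0 μ₀ := by
  obtain ⟨K, hK, mK, hsK, f, B, hB, rfl, hf⟩ := hm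
  have hac : μ₁ ≪ μ₀ := hμ ▸ withDensity_absolutelyContinuous _ _
  -- The likelihood ratio of what the public information says about the other agents. Where `μ₀ (B k
  -- i) = 0`, also `μ₁ (B k i) = 0`, and the value of the quotient is immaterial.
  let γ : K → ℝ≥0 := fun k => ∏ i ∈ Finset.univ.erase j, (μ₁ (B k i) / μ₀ (B k i)).toNNReal
  refine ⟨fun z => γ (f z), ?_, fun D hD => ?_⟩
  · have : Measurable γ := measurable_of_finite γ
    exact this.comp (comap_measurable f)
  rw [← MeasurableSpace.comap_prodMk] at hD
  obtain ⟨T, hT, rfl⟩ := hD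
  -- The part of the event on the fibre over `k` is again a box: only side `j` is cut, by the slice
  -- of `T`.
  let C : K → Fin n → Set Ω := fun k => Function.update (B k) j (B k j ∩ (fun a => (a, k)) ⁻¹' T)
  have hC : ∀ k i, MeasurableSet (C k i) := fun k i => by
    by_cases hi : i = j
    · subst hi
      simpa only [C, Function.update_self] using (hB k i).inter (measurable_prodMk_right hT)
    · simpa [C, hi] using hB k i
  have hCm : ∀ k z, z ∈ (Prod.snd ⁻¹' Set.univ.pi (C k) : Set (Outcome n Ω)) ↔
      (signal j z, f z) ∈ T ∧ f z = k := fun k z => by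
    have hfk : f z = k ↔ ∀ i, z.2 i ∈ B k i := by
      simpa using Set.ext_iff.1 (hf k) z
    constructor
    · intro hz
      have hz' : ∀ i, z.2 i ∈ C k i := by simpa using hz
      have hj : z.2 j ∈ B k j ∧ (z.2 j, k) ∈ T := by simpa [C] using hz' j
      have hk : f z = k := hfk.2 fun i => by
        by_cases hi : i = j
        · rw [hi]; exact hj.1
        · simpa [C, hi] using hz' i
      exact ⟨by rw [hk]; exact hj.2, hk⟩
    · rintro ⟨h1, h2⟩
      have hz := hfk.1 h2
      rw [h2] at h1
      have : ∀ i, z.2 i ∈ C k i := fun i => by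
        by_cases hi : i = j
        · subst hi
          simpa [C] using ⟨hz i, h1⟩
        · simpa [C, hi] using hz i
      simpa using this
  have hU : (fun z => (signal j z, f z)) ⁻¹' T =
      ⋃ k, (Prod.snd ⁻¹' Set.univ.pi (C k) : Set (Outcome n Ω)) := by
    ext z
    simp only [Set.mem_iUnion, hCm]
    simp
  have hdisj : Pairwise (Function.onFun Disjoint fun k =>
      (Prod.snd ⁻¹' Set.univ.pi (C k) : Set (Outcome n Ω))) := fun k k' hkk' =>
    Set.disjoint_left.2 fun z hz hz' =>
      hkk' (((hCm k z).1 hz).2.symm.trans ((hCm k' z).1 hz').2)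
  have hmeas : ∀ k, MeasurableSet (Prod.snd ⁻¹' Set.univ.pi (C k) : Set (Outcome n Ω)) := fun k =>
    measurable_snd (MeasurableSet.univ_pi (hC k))
  rw [hU, measure_iUnion hdisj hmeas, lintegral_iUnion hmeas hdisj]
  refine tsum_congr fun k => ?_
  have hγ : ∀ z ∈ (Prod.snd ⁻¹' Set.univ.pi (C k) : Set (Outcome n Ω)),
      ((l (signal j z) * γ (f z) : ℝ≥0) : ℝ≥0∞) =
        γ k * ∏ i, Function.update (fun _ _ => 1) j (fun a => (l a : ℝ≥0∞)) i (z.2 i) := by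
    intro z hz
    rw [((hCm k z).1 hz).2, ENNReal.coe_mul, mul_comm, Fintype.prod_eq_single j]
    · simp [signal]
    · intro i hi
      simp [hi]
  have hup : ∀ i, Measurable (Function.update (fun (_ : Fin n) (_ : Ω) => (1 : ℝ≥0∞)) j
      (fun a => (l a : ℝ≥0∞)) i) := fun i => by
    by_cases hi : i = j
    · subst hi
      simpa using hl.coe_nnreal_ennreal
    · simp [hi]
  have hprod : Measurable fun x : Fin n → Ω =>
      ∏ i, Function.update (fun _ _ => (1 : ℝ≥0∞)) j (fun a => (l a : ℝ≥0∞)) i (x i) :=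
    Finset.measurable_fun_prod _ fun i _ => (hup i).comp (measurable_pi_apply i)
  rw [setLIntegral_congr_fun (hmeas k) hγ,
    setLIntegral_stateLaw 0 μ₀ (MeasurableSet.univ_pi (hC k))
      (f := fun x => γ k * ∏ i, Function.update (fun _ _ => 1) j (fun a => (l a : ℝ≥0∞)) i (x i))
      (hprod.const_mul _),
    lintegral_const_mul _ hprod,
    setLIntegral_pi_prod (fun _ => μ₀) hup (hC k),
    stateLaw_preimage_snd 1 μ₁ (MeasurableSet.univ_pi (hC k)), Measure.pi_pi,
    ← Finset.mul_prod_erase _ _ (Finset.mem_univ j), ← Finset.mul_prod_erase _ _ (Finset.mem_univ j),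
    mul_left_comm]
  congr 1
  · rw [Function.update_self, ← withDensity_apply _ (hC k j), ← hμ]
  · rw [ENNReal.ofNNReal_finsetProd, ← Finset.prod_mul_distrib]
    refine Finset.prod_congr rfl fun i hi => ?_
    have hi' : i ≠ j := Finset.ne_of_mem_erase hi
    have hCi : C k i = B k i := by simp [C, hi']
    rw [Function.update_of_ne hi', hCi, setLIntegral_one]
    by_cases h0 : μ₀ (B k i) = 0
    · simp [h0, hac h0]
    · rw [ENNReal.coe_toNNReal (ENNReal.div_ne_top (measure_ne_top _ _) h0),
        ENNReal.div_mul_cancel h0 (measure_ne_top _ _)]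

/-! ### Comparing conditional expectations on an event of the smaller σ-algebra -/

section CondExp

variable {α : Type*} {H G m₀ : MeasurableSpace α} {P : Measure α} [IsFiniteMeasure P]
  {f : α → ℝ} {N : Set α} {c : ℝ}

theorem condExp_le_on_of_condExp_le_on (hHG : H ≤ G) (hG : G ≤ m₀)
    (hN : MeasurableSet[H] N) (h : ∀ᵐ z ∂P, z ∈ N → P[f | G] z ≤ c) :
    ∀ᵐ z ∂P, z ∈ N → P[f | H] z ≤ c := by
  have h1 : P[N.indicator P[f | G] | H] ≤ᵐ[P] P[N.indicator (fun _ => c) | H] := by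
    refine condExp_mono (integrable_condExp.indicator (hG _ (hHG _ hN)))
      ((integrable_const c).indicator (hG _ (hHG _ hN))) ?_
    filter_upwards [h] with z hz
    by_cases hzN : z ∈ N <;> simp [hzN, hz]
  have h2 : P[N.indicator (fun _ => c) | H] = N.indicator (fun _ => c) :=
    condExp_of_stronglyMeasurable (hHG.trans hG) (stronglyMeasurable_const.indicator hN)
      ((integrable_const c).indicator (hG _ (hHG _ hN)))
  filter_upwards [h1, condExp_indicator (integrable_condExp (m := G) (f := f)) hN,
    condExp_condExp_of_le (f := f) (μ := P) hHG hG] with z hz1 hz2 hz3 hzN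
  rwa [h2, hz2, Set.indicator_of_mem hzN, Set.indicator_of_mem hzN, hz3] at hz1

/-- Both conditional expectations have the same integral over `N`, so the nonnegative gap `c - P[f |
G]` integrates to 0 there. -/
theorem condExp_eq_on_of_condExp_le_on (hf : Integrable f P) (hHG : H ≤ G) (hG : G ≤ m₀)
    (hN : MeasurableSet[H] N) (h : ∀ᵐ z ∂P, z ∈ N → P[f | G] z ≤ c)
    (hH : ∀ᵐ z ∂P, z ∈ N → P[f | H] z = c) :
    ∀ᵐ z ∂P, z ∈ N → P[f | G] z = c := by
  have hN' : MeasurableSet N := hG _ (hHG _ hN)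
  have hint : IntegrableOn (fun z => c - P[f | G] z) N P :=
    ((integrable_const c).sub integrable_condExp).integrableOn
  have hnn : 0 ≤ᵐ[P.restrict N] fun z => c - P[f | G] z := by
    rw [EventuallyLE, ae_restrict_iff' hN']
    filter_upwards [h] with z hz hzN
    simpa using hz hzN
  have h0 : ∫ z in N, (c - P[f | G] z) ∂P = 0 := by
    rw [integral_sub (integrable_const c).integrableOn integrable_condExp.integrableOn,
      setIntegral_condExp hG hf (hHG _ hN), ← setIntegral_condExp (hHG.trans hG) hf hN,
      setIntegral_congr_ae hN' hH, sub_self]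
  have := (setIntegral_eq_zero_iff_of_nonneg_ae hnn hint).1 h0
  rw [EventuallyEq, ae_restrict_iff' hN'] at this
  filter_upwards [this] with z hz hzN
  exact (sub_eq_zero.1 (hz hzN)).symm

theorem le_condExp_on_of_le_condExp_on (hHG : H ≤ G) (hG : G ≤ m₀)
    (hN : MeasurableSet[H] N) (h : ∀ᵐ z ∂P, z ∈ N → c ≤ P[f | G] z) :
    ∀ᵐ z ∂P, z ∈ N → c ≤ P[f | H] z := by
  have := condExp_le_on_of_condExp_le_on (f := -f) (c := -c) hHG hG hN (by
    filter_upwards [h, condExp_neg (μ := P) f G] with z hz hz' hzN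
    rw [hz']; exact neg_le_neg (hz hzN))
  filter_upwards [this, condExp_neg (μ := P) f H] with z hz hz' hzN
  have := hz hzN
  rw [hz'] at this
  exact neg_le_neg_iff.1 this

theorem condExp_eq_on_of_le_condExp_on (hf : Integrable f P) (hHG : H ≤ G) (hG : G ≤ m₀)
    (hN : MeasurableSet[H] N) (h : ∀ᵐ z ∂P, z ∈ N → c ≤ P[f | G] z)
    (hH : ∀ᵐ z ∂P, z ∈ N → P[f | H] z = c) :
    ∀ᵐ z ∂P, z ∈ N → P[f | G] z = c := by
  have := condExp_eq_on_of_condExp_le_on (f := -f) (c := -c) hf.neg hHG hG hN (by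
    filter_upwards [h, condExp_neg (μ := P) f G] with z hz hz' hzN
    rw [hz']; exact neg_le_neg (hz hzN)) (by
    filter_upwards [hH, condExp_neg (μ := P) f H] with z hz hz' hzN
    rw [hz']; exact congrArg Neg.neg (hz hzN))
  filter_upwards [this, condExp_neg (μ := P) f G] with z hz hz' hzN
  have := hz hzN
  rw [hz'] at this
  exact neg_injective this

/-- If a conditional expectation agrees on an event of a smaller `σ`-algebra with a function that
is measurable with respect to this `σ`-algebra, then it agrees there with the conditional
expectation on the smaller `σ`-algebra. -/
theorem condExp_eq_on_of_eq_stronglyMeasurable (hHG : H ≤ G) (hG : G ≤ m₀)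
    (hN : MeasurableSet[H] N) {q : α → ℝ} (hq : StronglyMeasurable[H] q)
    (h : ∀ᵐ z ∂P, z ∈ N → P[f | G] z = q z) :
    ∀ᵐ z ∂P, z ∈ N → P[f | H] z = P[f | G] z := by
  have hm : AEStronglyMeasurable[H] (N.indicator P[f | G]) P := by
    refine (hq.indicator hN).aestronglyMeasurable.congr ?_
    filter_upwards [h] with z hz
    by_cases hzN : z ∈ N <;> simp [hzN, hz]
  filter_upwards [condExp_of_aestronglyMeasurable' (hHG.trans hG) hm
      (integrable_condExp.indicator (hG _ (hHG _ hN))),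
    condExp_indicator (integrable_condExp (m := G) (f := f)) hN,
    condExp_condExp_of_le (f := f) (μ := P) hHG hG] with z hz1 hz2 hz3 hzN
  rwa [hz2, Set.indicator_of_mem hzN, Set.indicator_of_mem hzN, hz3] at hz1

end CondExp

/-! ### Filtrations of public and private information -/

theorem comap_signal_le (j : Fin n) :
    MeasurableSpace.comap (signal (Ω := Ω) j) inferInstance ≤
      MeasurableSpace.comap Prod.snd inferInstance :=
  ((measurable_pi_apply j).comp (comap_measurable Prod.snd)).comap_le

theorem publicInfo_le_comap_snd (μ₀ μ₁ : Measure Ω) (t : ℕ) :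
    publicInfo (n := n) μ₀ μ₁ t ≤ MeasurableSpace.comap Prod.snd inferInstance := by
  induction t with
  | zero => exact bot_le
  | succ t ih =>
    exact sup_le ih (iSup_le fun j => (measurable_voteGiven μ₀ μ₁ _ j).comap_le.trans
      (sup_le (comap_signal_le j) ih))

theorem comap_snd_le :
    MeasurableSpace.comap Prod.snd inferInstance ≤ (inferInstance : MeasurableSpace (Outcome n Ω)) :=
  measurable_snd.comap_le

theorem publicInfo_mono (μ₀ μ₁ : Measure Ω) : Monotone (publicInfo (n := n) μ₀ μ₁) :=
  monotone_nat_of_le_succ fun _ => le_sup_left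

/-- The increasing family of public informations. -/
noncomputable def publicFiltration (n : ℕ) (μ₀ μ₁ : Measure Ω) :
    Filtration ℕ (inferInstance : MeasurableSpace (Outcome n Ω)) where
  seq := publicInfo μ₀ μ₁
  mono' := publicInfo_mono μ₀ μ₁
  le' t := (publicInfo_le_comap_snd μ₀ μ₁ t).trans comap_snd_le

/-- The increasing family of informations of agent `j`. -/
noncomputable def agentFiltration (μ₀ μ₁ : Measure Ω) (j : Fin n) :
    Filtration ℕ (inferInstance : MeasurableSpace (Outcome n Ω)) where
  seq t := MeasurableSpace.comap (signal j) inferInstance ⊔ publicInfo μ₀ μ₁ t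
  mono' _ _ h := sup_le_sup_left (publicInfo_mono μ₀ μ₁ h) _
  le' t := info_le μ₀ μ₁ t j

theorem agentFiltration_le (μ₀ μ₁ : Measure Ω) (j : Fin n) :
    ⨆ t, agentFiltration μ₀ μ₁ j t ≤ (inferInstance : MeasurableSpace (Outcome n Ω)) :=
  iSup_le fun t => (agentFiltration μ₀ μ₁ j).le t

theorem publicFiltration_le_comap_snd (μ₀ μ₁ : Measure Ω) :
    ⨆ t, publicFiltration n μ₀ μ₁ t ≤ MeasurableSpace.comap Prod.snd inferInstance :=
  iSup_le fun t => publicInfo_le_comap_snd μ₀ μ₁ t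

theorem publicFiltration_le_agentFiltration (μ₀ μ₁ : Measure Ω) (j : Fin n) :
    ⨆ t, publicFiltration n μ₀ μ₁ t ≤ ⨆ t, agentFiltration μ₀ μ₁ j t :=
  iSup_mono fun _ => le_sup_right

theorem measurableSet_frequently_vote (μ₀ μ₁ : Measure Ω) (j : Fin n) (b : Fin 2) :
    MeasurableSet[⨆ t, publicFiltration n μ₀ μ₁ t]
      {z | ∃ᶠ t in atTop, voteGiven μ₀ μ₁ (publicInfo μ₀ μ₁ t) j z = b} := by
  have e : {z | ∃ᶠ t in atTop, voteGiven μ₀ μ₁ (publicInfo μ₀ μ₁ t) j z = b} =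
      ⋂ s : ℕ, ⋃ t : ℕ, ⋃ _ : s ≤ t, voteGiven μ₀ μ₁ (publicInfo μ₀ μ₁ t) j ⁻¹' {b} := by
    ext z
    simp [frequently_atTop]
  rw [e]
  refine MeasurableSet.iInter fun s => MeasurableSet.iUnion fun t => MeasurableSet.iUnion fun _ => ?_
  -- The vote cast on the basis of `publicInfo t` becomes public only at index `t + 1`.
  refine le_iSup (fun t => publicInfo (n := n) μ₀ μ₁ t) (t + 1) _ ?_
  refine le_sup_of_le_right (le_iSup (fun j : Fin n =>
    MeasurableSpace.comap (voteGiven μ₀ μ₁ (publicInfo μ₀ μ₁ t) j) inferInstance) j) _ ?_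
  exact ⟨{b}, measurableSet_singleton b, rfl⟩

theorem measurableSet_state : MeasurableSet {y : Outcome n Ω | state y = 1} :=
  measurable_fst (measurableSet_singleton (1 : Fin 2))

/-- The limiting conditional probability of state `1` given the votes of all rounds. -/
noncomputable abbrev publicBelief (n : ℕ) (μ₀ μ₁ : Measure Ω) : Outcome n Ω → ℝ :=
  (law n μ₀ μ₁)⟦{y | state y = 1} | ⨆ t, publicFiltration n μ₀ μ₁ t⟧

/-- The limiting conditional probability of state `1` given the signal of agent `j` and the votes
of all rounds. -/
noncomputable abbrev agentBelief (μ₀ μ₁ : Measure Ω) (j : Fin n) : Outcome n Ω → ℝ :=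
  (law n μ₀ μ₁)⟦{y | state y = 1} | ⨆ t, agentFiltration μ₀ μ₁ j t⟧

/-! ### Limiting beliefs and infinitely repeated votes -/

section Limit

variable (μ₀ μ₁ : Measure Ω) [IsProbabilityMeasure μ₀] [IsProbabilityMeasure μ₁]

theorem integrable_state :
    Integrable ({y : Outcome n Ω | state y = 1}.indicator fun _ => (1 : ℝ)) (law n μ₀ μ₁) :=
  (integrable_const 1).indicator measurableSet_state

/-- By Lévy's upward theorem the beliefs converge, and a bound that holds infinitely often passes to
the limit. -/
theorem limit_belief_le_of_frequently_zero (j : Fin n) :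
    ∀ᵐ z ∂law n μ₀ μ₁, (∃ᶠ t in atTop, voteGiven μ₀ μ₁ (publicInfo μ₀ μ₁ t) j z = 0) →
      agentBelief μ₀ μ₁ j z ≤ 1 / 2 := by
  filter_upwards [tendsto_ae_condExp (μ := law n μ₀ μ₁) (ℱ := agentFiltration μ₀ μ₁ j)
    ({y : Outcome n Ω | state y = 1}.indicator fun _ => (1 : ℝ))] with z hz hfr
  refine le_of_tendsto_of_frequently hz (hfr.mono fun t ht => ?_)
  by_contra hlt
  have : voteGiven μ₀ μ₁ (publicInfo μ₀ μ₁ t) j z = 1 := if_pos (not_le.1 hlt)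
  simp [this] at ht

theorem le_limit_belief_of_frequently_one (j : Fin n) :
    ∀ᵐ z ∂law n μ₀ μ₁, (∃ᶠ t in atTop, voteGiven μ₀ μ₁ (publicInfo μ₀ μ₁ t) j z = 1) →
      1 / 2 ≤ agentBelief μ₀ μ₁ j z := by
  filter_upwards [tendsto_ae_condExp (μ := law n μ₀ μ₁) (ℱ := agentFiltration μ₀ μ₁ j)
    ({y : Outcome n Ω | state y = 1}.indicator fun _ => (1 : ℝ))] with z hz hfr
  refine ge_of_tendsto_of_frequently hz (hfr.mono fun t ht => ?_)
  by_contra hlt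
  have : voteGiven μ₀ μ₁ (publicInfo μ₀ μ₁ t) j z = 0 := if_neg fun h => hlt h.le
  simp [this] at ht

/-- Where the limiting public belief is `1/2`, so is the limiting belief of each agent. -/
theorem limit_belief_eq_half (j : Fin n) :
    ∀ᵐ z ∂law n μ₀ μ₁,
      publicBelief n μ₀ μ₁ z = 1 / 2 →
      agentBelief μ₀ μ₁ j z = 1 / 2 := by
  set H := ⨆ t, publicFiltration n μ₀ μ₁ t with hH
  have hE : MeasurableSet[H] {z | publicBelief n μ₀ μ₁ z = 1 / 2} :=
    stronglyMeasurable_condExp.measurable (measurableSet_singleton (1 / 2 : ℝ))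
  have h0 := condExp_eq_on_of_condExp_le_on (integrable_state μ₀ μ₁)
    (publicFiltration_le_agentFiltration μ₀ μ₁ j) (agentFiltration_le μ₀ μ₁ j)
    (hE.inter (measurableSet_frequently_vote μ₀ μ₁ j 0))
    ((limit_belief_le_of_frequently_zero μ₀ μ₁ j).mono fun z hz hzN => hz hzN.2)
    (ae_of_all _ fun z hz => hz.1)
  have h1 := condExp_eq_on_of_le_condExp_on (integrable_state μ₀ μ₁)
    (publicFiltration_le_agentFiltration μ₀ μ₁ j) (agentFiltration_le μ₀ μ₁ j)
    (hE.inter (measurableSet_frequently_vote μ₀ μ₁ j 1))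
    ((le_limit_belief_of_frequently_one μ₀ μ₁ j).mono fun z hz hzN => hz hzN.2)
    (ae_of_all _ fun z hz => hz.1)
  filter_upwards [h0, h1] with z hz0 hz1 hz
  -- At least one of the two votes occurs infinitely often, so the two public events cover
  -- everything.
  have : ∃ᶠ t : ℕ in atTop, voteGiven μ₀ μ₁ (publicInfo μ₀ μ₁ t) j z = 0 ∨
      voteGiven μ₀ μ₁ (publicInfo μ₀ μ₁ t) j z = 1 :=
    Frequently.of_forall fun t => by
      generalize voteGiven μ₀ μ₁ (publicInfo μ₀ μ₁ t) j z = b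
      fin_cases b <;> simp
  rcases frequently_or_distrib.1 this with h | h
  · exact hz0 ⟨hz, h⟩
  · exact hz1 ⟨hz, h⟩

/-- Where the limiting public belief is not `1/2`, the votes of all agents agree eventually. -/
theorem unanimity_of_limit_belief_ne_half :
    ∀ᵐ z ∂law n μ₀ μ₁,
      publicBelief n μ₀ μ₁ z ≠ 1 / 2 →
      ∃ V : Fin 2, ∀ᶠ t in atTop, ∀ j, voteGiven μ₀ μ₁ (publicInfo μ₀ μ₁ t) j z = V := by
  have h0 := fun j : Fin n => condExp_le_on_of_condExp_le_on
    (publicFiltration_le_agentFiltration μ₀ μ₁ j) (agentFiltration_le μ₀ μ₁ j)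
    (measurableSet_frequently_vote μ₀ μ₁ j 0) (limit_belief_le_of_frequently_zero μ₀ μ₁ j)
  have h1 := fun j : Fin n => le_condExp_on_of_le_condExp_on
    (publicFiltration_le_agentFiltration μ₀ μ₁ j) (agentFiltration_le μ₀ μ₁ j)
    (measurableSet_frequently_vote μ₀ μ₁ j 1) (le_limit_belief_of_frequently_one μ₀ μ₁ j)
  filter_upwards [ae_all_iff.2 h0, ae_all_iff.2 h1] with z hz0 hz1 hne
  rcases lt_or_gt_of_ne hne with hlt | hgt
  · refine ⟨0, eventually_all.2 fun j => ?_⟩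
    have := not_frequently.1 fun hfr => (hz1 j hfr).not_gt hlt
    exact this.mono fun t ht => by omega
  · refine ⟨1, eventually_all.2 fun j => ?_⟩
    have := not_frequently.1 fun hfr => (hz0 j hfr).not_gt hgt
    exact this.mono fun t ht => by omega

end Limit

/-! ### Posterior odds, and exclusion of the limiting public belief 1/2 -/

section Density

variable {μ₀ μ₁ : Measure Ω} [IsProbabilityMeasure μ₀] [IsProbabilityMeasure μ₁] {l : Ω → ℝ≥0}

theorem stateLaw_zero_state (μ : Measure Ω) [IsProbabilityMeasure μ] :
    stateLaw n 0 μ {y | state y = 1} = 0 := by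
  have : {y : Outcome n Ω | state y = 1} = Prod.fst ⁻¹' {1} := rfl
  rw [this, stateLaw, measurePreserving_fst.measure_preimage (by measurability)]
  simp

theorem stateLaw_one_state_compl (μ : Measure Ω) [IsProbabilityMeasure μ] :
    stateLaw n 1 μ {y | state y = 1}ᶜ = 0 := by
  have : {y : Outcome n Ω | state y = 1}ᶜ = Prod.fst ⁻¹' {1}ᶜ := rfl
  rw [this, stateLaw, measurePreserving_fst.measure_preimage (by measurability)]
  simp

/-- The posterior probability of state `1` given all signals. -/
theorem condExp_state_comap_snd (hl : Measurable l) (hμ : μ₁ = μ₀.withDensity fun a => l a) :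
    (fun z : Outcome n Ω => ((∏ i, l (signal i z) : ℝ≥0) : ℝ) / (1 + (∏ i, l (signal i z) : ℝ≥0)))
      =ᵐ[law n μ₀ μ₁]
      (law n μ₀ μ₁)⟦{y | state y = 1} | MeasurableSpace.comap Prod.snd inferInstance⟧ := by
  have hm : Measurable fun x : Fin n → Ω => ∏ i, l (x i) :=
    Finset.measurable_fun_prod _ fun i _ => hl.comp (measurable_pi_apply i)
  refine condExp_half_add_half (P₀ := stateLaw n 0 μ₀) (P₁ := stateLaw n 1 μ₁)
    (r := fun z => ∏ i, l (signal i z)) comap_snd_le measurableSet_state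
    (stateLaw_zero_state μ₀) (stateLaw_one_state_compl μ₁)
    (hm.comp (comap_measurable Prod.snd)) ?_
  rintro D ⟨D', hD', rfl⟩
  rw [stateLaw_preimage_snd _ _ hD', pi_withDensity μ₀ μ₁ hl.coe_nnreal_ennreal hμ,
    withDensity_apply _ hD']
  refine Eq.trans ?_ (setLIntegral_stateLaw 0 μ₀ hD' hm.coe_nnreal_ennreal).symm
  simp

/-- The belief of an agent in a round is determined by the likelihood ratio of its signal and by
the public information. -/
theorem exists_condExp_state_agentFiltration (hl : Measurable l)
    (hμ : μ₁ = μ₀.withDensity fun a => l a) (j : Fin n) (t : ℕ) :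
    ∃ g : Outcome n Ω → ℝ≥0, Measurable[publicInfo μ₀ μ₁ t] g ∧
      (fun z => ((l (signal j z) * g z : ℝ≥0) : ℝ) / (1 + (l (signal j z) * g z : ℝ≥0)))
        =ᵐ[law n μ₀ μ₁] (law n μ₀ μ₁)⟦{y | state y = 1} | agentFiltration μ₀ μ₁ j t⟧ := by
  obtain ⟨g, hg, hD⟩ := (generatedByBoxes_publicInfo μ₀ μ₁ t).exists_density μ₀ μ₁ hl hμ j
  refine ⟨g, hg, ?_⟩
  refine condExp_half_add_half (P₀ := stateLaw n 0 μ₀) (P₁ := stateLaw n 1 μ₁)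
    (r := fun z => l (signal j z) * g z) ((agentFiltration μ₀ μ₁ j).le t) measurableSet_state
    (stateLaw_zero_state μ₀) (stateLaw_one_state_compl μ₁) ?_ hD
  exact Measurable.mul
    (hl.comp ((comap_measurable (signal j)).mono le_sup_left le_rfl)) (hg.mono le_sup_right le_rfl)

theorem ae_law_signal {p : Ω → Prop} (hac : μ₁ ≪ μ₀) (hp : ∀ᵐ a ∂μ₀, p a) (j : Fin n) :
    ∀ᵐ z ∂law n μ₀ μ₁, p (signal j z) := by
  have h (s : Fin 2) (μ : Measure Ω) [IsProbabilityMeasure μ] (hp : ∀ᵐ a ∂μ, p a) :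
      ∀ᵐ z ∂stateLaw n s μ, p (signal j z) :=
    ((measurePreserving_eval (fun _ : Fin n => μ) j).comp
      measurePreserving_snd).quasiMeasurePreserving.ae hp
  rw [law_eq, ae_add_measure_iff, Measure.ae_ennreal_smul_measure_iff (by simp),
    Measure.ae_ennreal_smul_measure_iff (by simp)]
  exact ⟨h 0 μ₀ hp, h 1 μ₁ (hac.ae_le hp)⟩

/-- Where the limiting belief of agent `j` is `1/2`, the likelihood ratio of its signal is
determined by the public information. -/
theorem exists_stronglyMeasurable_eq_inv_signal (hl : Measurable l)
    (hμ : μ₁ = μ₀.withDensity fun a => l a) (hpos : ∀ᵐ a ∂μ₀, l a ≠ 0) (j : Fin n) :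
    ∃ w : Outcome n Ω → ℝ, StronglyMeasurable[⨆ t, publicFiltration n μ₀ μ₁ t] w ∧
      ∀ᵐ z ∂law n μ₀ μ₁, agentBelief μ₀ μ₁ j z = 1 / 2 → w z = (l (signal j z) : ℝ)⁻¹ := by
  choose g hg hgz using exists_condExp_state_agentFiltration (n := n) hl hμ j
  -- `limUnder` is measurable even where the limit fails to exist; its default value there is
  -- harmless.
  refine ⟨fun z => limUnder atTop fun t => (g t z : ℝ), ?_, ?_⟩
  · refine @StronglyMeasurable.limUnder _ _ _ (⨆ t, publicFiltration n μ₀ μ₁ t) _ _ _ _ _ _ _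
      fun t => ?_
    exact ((hg t).coe_nnreal_real.stronglyMeasurable).mono
      (le_iSup (fun t => publicInfo (n := n) μ₀ μ₁ t) t)
  have hac : μ₁ ≪ μ₀ := hμ ▸ withDensity_absolutelyContinuous _ _
  filter_upwards [ae_all_iff.2 hgz, ae_law_signal hac hpos j,
    tendsto_ae_condExp (μ := law n μ₀ μ₁) (ℱ := agentFiltration μ₀ μ₁ j)
    ({y : Outcome n Ω | state y = 1}.indicator fun _ => (1 : ℝ))] with z hz hlz hlim hhalf
  refine Tendsto.limUnder_eq ?_
  replace hlim : Tendsto _ _ (𝓝 (agentBelief μ₀ μ₁ j z)) := hlim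
  rw [hhalf] at hlim
  have hl0 : (l (signal j z) : ℝ) ≠ 0 := by exact_mod_cast hlz
  -- Passing from beliefs to odds turns the limit 1/2 into 1; dividing by the signal's ratio
  -- isolates `g t`.
  have h2 := (hlim.div (tendsto_const_nhds (x := (1 : ℝ)) |>.sub hlim) (by norm_num)).mul_const
    (l (signal j z) : ℝ)⁻¹
  have e : (1 / 2 : ℝ) / (1 - 1 / 2) * (l (signal j z) : ℝ)⁻¹ = (l (signal j z) : ℝ)⁻¹ := by
    norm_num
  rw [e] at h2
  refine h2.congr fun t => ?_
  simp only [Pi.div_apply]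
  rw [← hz t]
  push_cast
  have : (1 + (l (signal j z) : ℝ) * g t z) ≠ 0 := by positivity
  field_simp
  ring

theorem law_prod_eq_one_null (hn : n ≠ 0) (hl : Measurable l)
    (h₀ : ∀ c, c ≠ 0 → μ₀ {a | l a = c} = 0) (h₁ : ∀ c, c ≠ 0 → μ₁ {a | l a = c} = 0) :
    ∀ᵐ z ∂law n μ₀ μ₁, ∏ i, l (signal i z) ≠ 1 := by
  have hm : MeasurableSet {x : Fin n → Ω | ∏ i, l (x i) = 1} :=
    (Finset.measurable_fun_prod _ fun i _ => hl.comp (measurable_pi_apply i))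
      (measurableSet_singleton 1)
  have e : {z : Outcome n Ω | ¬ ∏ i, l (signal i z) ≠ 1} =
    Prod.snd ⁻¹' {x : Fin n → Ω | ∏ i, l (x i) = 1} := by ext z; simp [signal]
  rw [ae_iff, e, law_eq, Measure.add_apply, Measure.smul_apply, Measure.smul_apply,
    stateLaw_preimage_snd _ _ hm, stateLaw_preimage_snd _ _ hm, pi_prod_eq_one_null hn _ hl h₀,
    pi_prod_eq_one_null hn _ hl h₁]
  simp

/-- The limiting public belief is almost surely different from `1/2`. -/
theorem limit_belief_ne_half (hn : n ≠ 0) (hl : Measurable l)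
    (hμ : μ₁ = μ₀.withDensity fun a => l a) (hpos : ∀ᵐ a ∂μ₀, l a ≠ 0)
    (h₀ : ∀ c, c ≠ 0 → μ₀ {a | l a = c} = 0) (h₁ : ∀ c, c ≠ 0 → μ₁ {a | l a = c} = 0) :
    ∀ᵐ z ∂law n μ₀ μ₁, publicBelief n μ₀ μ₁ z ≠ 1 / 2 := by
  have hac : μ₁ ≪ μ₀ := hμ ▸ withDensity_absolutelyContinuous _ _
  choose w hw hwz using exists_stronglyMeasurable_eq_inv_signal (n := n) hl hμ hpos
  have hE : MeasurableSet[⨆ t, publicFiltration n μ₀ μ₁ t]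
      {z | publicBelief n μ₀ μ₁ z = 1 / 2} :=
    stronglyMeasurable_condExp.measurable (measurableSet_singleton (1 / 2 : ℝ))
  -- On the event, `w j` is the inverse ratio of signal `j`, so this public function is the
  -- posterior given all signals.
  have hq : StronglyMeasurable[⨆ t, publicFiltration n μ₀ μ₁ t]
      fun z => (1 + ∏ j, w j z)⁻¹ :=
    ((Finset.measurable_fun_prod _ fun j _ => (hw j).measurable).const_add
      1).inv.stronglyMeasurable
  have key := condExp_eq_on_of_eq_stronglyMeasurable (P := law n μ₀ μ₁)
    (f := {y : Outcome n Ω | state y = 1}.indicator fun _ => (1 : ℝ))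
    (publicFiltration_le_comap_snd μ₀ μ₁) comap_snd_le hE hq (by
      filter_upwards [ae_all_iff.2 hwz, ae_all_iff.2 (limit_belief_eq_half (n := n) μ₀ μ₁),
        condExp_state_comap_snd (n := n) hl hμ,
        ae_all_iff.2 (ae_law_signal (n := n) hac hpos)] with z h1 h2 h3 h4 hz
      rw [← h3, Finset.prod_congr rfl fun j _ => h1 j (h2 j hz), Finset.prod_inv_distrib]
      have : ((∏ i, l (signal i z) : ℝ≥0) : ℝ) ≠ 0 := by
        exact_mod_cast Finset.prod_ne_zero_iff.2 fun i _ => h4 i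
      push_cast at this ⊢
      field_simp
      rw [add_comm])
  filter_upwards [key, condExp_state_comap_snd (n := n) hl hμ,
    law_prod_eq_one_null hn hl h₀ h₁] with z h1 h2 h3 hz
  have h4 := h1 hz
  rw [← h2] at h4
  have h5 : publicBelief n μ₀ μ₁ z = _ := h4
  rw [hz] at h5
  refine h3 (NNReal.coe_injective ?_)
  have : (1 + ((∏ i, l (signal i z) : ℝ≥0) : ℝ)) ≠ 0 := by positivity
  rw [div_eq_div_iff two_ne_zero this] at h5
  rw [NNReal.coe_one]
  linarith

end Density

/-! ### From the log-likelihood assumptions to a finite density -/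

namespace IsAdmissible

variable {μ₀ μ₁ : Measure Ω}

theorem measure_llr_eq (h : IsAdmissible μ₀ μ₁) (x : ℝ) :
    μ₀ (llr μ₁ μ₀ ⁻¹' {x}) = 0 ∧ μ₁ (llr μ₁ μ₀ ⁻¹' {x}) = 0 := by
  have := h.nonatomic x
  rw [Measure.map_apply (measurable_llr _ _) (measurableSet_singleton x)] at this
  simpa using this

theorem unanimity [IsProbabilityMeasure μ₀] [IsProbabilityMeasure μ₁]
    (h : IsAdmissible μ₀ μ₁) (n : ℕ) :
    ∀ᵐ z ∂law n μ₀ μ₁, ∃ V : Fin 2,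
      ∀ᶠ t in atTop, ∀ j, voteGiven μ₀ μ₁ (publicInfo μ₀ μ₁ t) j z = V := by
  rcases eq_or_ne n 0 with rfl | hn
  -- Without agents the empty product is always 1 and the null-event argument fails, but the claim
  -- is vacuous.
  · exact ae_of_all _ fun z => ⟨0, Eventually.of_forall fun t j => j.elim0⟩
  have hfin := μ₁.rnDeriv_lt_top μ₀
  have hμ : μ₁ = μ₀.withDensity fun a => ((μ₁.rnDeriv μ₀ a).toNNReal : ℝ≥0∞) := by
    conv_lhs => rw [← Measure.withDensity_rnDeriv_eq μ₁ μ₀ h.absolutelyContinuous]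
    refine withDensity_congr_ae ?_
    filter_upwards [hfin] with a ha
    rw [ENNReal.coe_toNNReal ha.ne]
  have hpos : ∀ᵐ a ∂μ₀, (μ₁.rnDeriv μ₀ a).toNNReal ≠ 0 := by
    filter_upwards [hfin, h.rnDeriv_ne_zero] with a ha ha'
    exact (ENNReal.toNNReal_pos ha' ha.ne).ne'
  have hsub : ∀ c : ℝ≥0, {a | (μ₁.rnDeriv μ₀ a).toNNReal = c} ⊆
      llr μ₁ μ₀ ⁻¹' {Real.log c} := fun c a ha => by
    change Real.log (μ₁.rnDeriv μ₀ a).toReal = _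
    rw [← show (μ₁.rnDeriv μ₀ a).toNNReal = c from ha]
    rfl
  filter_upwards [unanimity_of_limit_belief_ne_half (n := n) μ₀ μ₁,
    limit_belief_ne_half (n := n) hn (μ₁.measurable_rnDeriv μ₀).ennreal_toNNReal hμ hpos
      (fun c _ => measure_mono_null (hsub c) (h.measure_llr_eq _).1)
      (fun c _ => measure_mono_null (hsub c) (h.measure_llr_eq _).2)] with z h1 h2
  exact h1 h2

end IsAdmissible

end RepeatedVoting

theorem theorem1 {Ω : Type*} [MeasurableSpace Ω] (n : ℕ) (μ₀ μ₁ : Measure Ω)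
    [IsProbabilityMeasure μ₀] [IsProbabilityMeasure μ₁]
    (h : RepeatedVoting.IsAdmissible μ₀ μ₁) :
    ∀ᵐ z ∂(RepeatedVoting.law n μ₀ μ₁), ∃ tᵤ : ℕ, 1 ≤ tᵤ ∧ ∃ V : Fin 2,
      ∀ t : ℕ, tᵤ ≤ t → ∀ i : Fin n, RepeatedVoting.vote μ₀ μ₁ t i z = V := by
  filter_upwards [h.unanimity n] with z hz
  obtain ⟨V, hV⟩ := hz
  obtain ⟨T, hT⟩ := Filter.eventually_atTop.1 hV
  -- Round `t` uses `publicInfo (t - 1)`, hence the shift by one.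
  exact ⟨T + 1, by omega, V, fun t ht i => hT (t - 1) (by omega) i⟩
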